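/- Let $d\in\mathbb N$, $\Omega=\{-1,1\}^{\mathbb Z^d}$ with the product topology, and let $C(\Omega)$ be the space of real continuous functions on $\Omega$ with the sup norm $\|\cdot\|_\infty$. For finite $A\subset\mathbb Z^d$ put $\sigma_A=\prod_{i\in A}\sigma_i$ (so $\sigma_\emptyset=1$). Let $\nabla_i f(\sigma)=f(\sigma^i)-f(\sigma)$, where $\sigma^i$ is $\sigma$ with the spin at $i$ flipped, and for finite $B\subset\mathbb Z^d$ let $$L_B f=\sum_{i\in\mathbb Z^d}\sigma_{B+i}\,\nabla_i f .$$ Let $\mathcal B$ be a (possibly infinite) set of finite subsets of $\mathbb Z^d$, let $\lambda(B)\in\mathbb R$ for $B\in\mathcal B$, and let $\mathcal L_{\mathcal B}$ be one of the two operators $$\mathcal L_{\mathcal B}f=\sum_{B\in\mathcal B}\lambda(B)\,L_Bf\qquad\text{or}\qquad \mathcal L_{\mathcal B}f=\sum_{B\in\mathcal B}\lambda(B)\,\sigma_B L_Bf ,$$ defined for those $f\in C(\Omega)$ with $\sum_i\|\nabla_i f\|_\infty<\infty$ and for which the series over $B$ converges absolutely in $C(\Omega)$. Assume that there are constants $c>0$,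 $u>0$ and a function $\psi:\mathbb N\to[0,\infty)$ with $$\sum_{B\in\mathcal B:\,|B|=k}|\lambda(B)|\le c\,\psi(k)\quad\text{for all } k\ge 0,\qquad \sum_{k=0}^\infty e^{uk}\psi(k)<\infty .$$ Then: 1. For every finite $A\subset\mathbb Z^d$ all powers $\mathcal L_{\mathcal B}^n\sigma_A$, $n\ge0$, are defined and lie in the above domain of $\mathcal L_{\mathcal B}$, and there is $\kappa>0$ (which may depend on $A$) such that $\|\mathcal L_{\mathcal B}^n\sigma_A\|_\infty\le n!\,\kappa^n$ for all $n\ge1$. 2. Every local function $f$ (one that depends on finitely many coordinates) is an analytic vector: all powers $\mathcal L_{\mathcal B}^nf$ are defined, and $\sum_{n\ge0}\frac{t^n}{n!}\|\mathcal L_{\mathcal B}^nf\|_\infty<\infty$ for some $t>0$. 3. The Markovian dynamics generated by $\mathcal L_{\mathcal B}$ is non-degenerate: if $(S(t))_{t\ge0}$ is a Feller semigroup on $C(\Omega)$ whose infinitesimal generator is the closure of $\mathcal L_{\mathcal B}$ restricted to local functions, then $\mu S(t)\ne\nu S(t)$ for all $t>0$ and all probability measures $\mu\neq\nu$ on $\Omega$,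 where $\mu S(t)$ is the law at time $t$ of the process started from $\mu$. -/

import Mathlib

open scoped NNReal ENNReal Topology Nat
open MeasureTheory ProbabilityTheory Filter

noncomputable section

namespace SpinFlip

/-- The lattice `ℤ^d`. -/
abbrev Site (d : ℕ) : Type := Fin d → ℤ

/-- Ising configurations `{-1, 1}^(ℤ^d)`, with the product topology and the product σ-algebra. -/
abbrev Config (d : ℕ) : Type := Site d → ℤˣ

/-- The σ-algebra on the configuration space is the Borel one. -/
instance instBorelSpaceConfig (d : ℕ) : BorelSpace (Config d) := by
  haveI h : MeasurableSingletonClass ℤˣ := ⟨fun s => by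
    have hs : ({s} : Set ℤˣ) = Units.val ⁻¹' {(s : ℤ)} := by
      ext x
      simp [Units.ext_iff]
    rw [hs]
    exact ⟨_, MeasurableSet.singleton (s : ℤ), rfl⟩⟩
  haveI : BorelSpace ℤˣ := ⟨by
    rw [borel_eq_top_of_discrete]
    exact top_le_iff.mp fun t _ => t.toFinite.measurableSet⟩
  infer_instance

variable {d : ℕ}

/-- The configuration `σ^i`, that is `σ` with the spin at the site `i` flipped. -/
def flip (i : Site d) : C(Config d, Config d) where
  toFun σ := Function.update σ i (-σ i)
  continuous_toFun := continuous_id.update i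
    (continuous_of_discreteTopology.comp (continuous_apply i))

/-- The discrete gradient `∇_i f (σ) = f (σ^i) - f σ`. -/
def grad (i : Site d) (f : C(Config d, ℝ)) : C(Config d, ℝ) := f.comp (flip i) - f

/-- The function `σ_A = ∏_{i ∈ A} σ_i`; in particular `σ_∅ = 1`. -/
def spin (A : Finset (Site d)) : C(Config d, ℝ) where
  toFun σ := ∏ i ∈ A, (((σ i : ℤˣ) : ℤ) : ℝ)
  continuous_toFun := continuous_finsetProd A fun i _ =>
    (continuous_of_discreteTopology (f := fun s : ℤˣ => ((s : ℤ) : ℝ))).comp (continuous_apply i)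

/-- The translate `B + i`. -/
def shift (B : Finset (Site d)) (i : Site d) : Finset (Site d) := B.map (addRightEmbedding i)

/-- The building block `L_B f = ∑_{i ∈ ℤ^d} σ_{B+i} ∇_i f`. The series converges absolutely in the
sup norm whenever `∑_i ‖∇_i f‖ < ∞`. -/
def blockGen (B : Finset (Site d)) (f : C(Config d, ℝ)) : C(Config d, ℝ) :=
  ∑' i : Site d, spin (shift B i) * grad i f

/-- The operator `f ↦ ∑_{B ∈ 𝓑} λ(B) σ_{q(B)} L_B f`. The choice `q(B) = ∅` gives the
translation-invariant `∑_B λ(B) L_B`, the choice `q(B) = B` gives `∑_B λ(B) σ_B L_B`. -/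
def gen (𝓑 : Set (Finset (Site d))) (lam : Finset (Site d) → ℝ)
    (q : Finset (Site d) → Finset (Site d)) (f : C(Config d, ℝ)) : C(Config d, ℝ) :=
  ∑' B : 𝓑, lam B • (spin (q B) * blockGen (B : Finset (Site d)) f)

/-- The functions on which the series that define `gen` converge absolutely in the sup norm. -/
structure InDomain (𝓑 : Set (Finset (Site d))) (lam : Finset (Site d) → ℝ)
    (q : Finset (Site d) → Finset (Site d)) (f : C(Config d, ℝ)) : Prop where
  summable_grad : Summable fun i : Site d => ‖grad i f‖
  summable_block :
    Summable fun B : 𝓑 => ‖lam B • (spin (q B) * blockGen (B : Finset (Site d)) f)‖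

/-- Local functions: those that depend on finitely many coordinates only. (Such functions are
automatically continuous.) -/
def IsLocal (f : C(Config d, ℝ)) : Prop :=
  ∃ Λ : Finset (Site d), DependsOn (f : Config d → ℝ) (Λ : Set (Site d))

/-- Analytic vectors of `𝓛 = gen 𝓑 lam q`: all the powers `𝓛^n f` are defined, and
`∑_n t^n / n! ‖𝓛^n f‖ < ∞` for some `t > 0`. -/
def IsAnalyticVector (𝓑 : Set (Finset (Site d))) (lam : Finset (Site d) → ℝ)
    (q : Finset (Site d) → Finset (Site d)) (f : C(Config d, ℝ)) : Prop :=
  (∀ n : ℕ, InDomain 𝓑 lam q ((gen 𝓑 lam q)^[n] f)) ∧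
    ∃ t : ℝ, 0 < t ∧ Summable fun n : ℕ => t ^ n / (n ! : ℝ) * ‖(gen 𝓑 lam q)^[n] f‖

/-- A Feller semigroup on the configuration space, given by its transition kernels
`P_t(σ, ·)`, the law at time `t` of the process started from `σ`. -/
structure FellerSemigroup (d : ℕ) where
  kernel : ℝ≥0 → Kernel (Config d) (Config d)
  markov : ∀ t, IsMarkovKernel (kernel t)
  kernel_zero : kernel 0 = Kernel.id
  kernel_add : ∀ s t, kernel (s + t) = kernel t ∘ₖ kernel s
  feller : ∀ t (f : C(Config d, ℝ)), Continuous fun σ => ∫ ξ, f ξ ∂(kernel t σ)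
  strong_continuity : ∀ f : C(Config d, ℝ),
    TendstoUniformly (fun t σ => ∫ ξ, f ξ ∂(kernel t σ)) f (𝓝 0)

namespace FellerSemigroup

/-- `S(t) f (σ) = ∫ f dP_t(σ, ·)`. -/
def act (S : FellerSemigroup d) (t : ℝ≥0) (f : C(Config d, ℝ)) : C(Config d, ℝ) where
  toFun σ := ∫ ξ, f ξ ∂(S.kernel t σ)
  continuous_toFun := S.feller t f

/-- The time-evolved measure `μ S(t) = ∫ P_t(σ, ·) μ(dσ)`. -/
def evolve (S : FellerSemigroup d) (t : ℝ≥0) (μ : Measure (Config d)) : Measure (Config d) :=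
  μ.bind (S.kernel t)

/-- The graph of the infinitesimal generator of `S` in `C(Ω)` with the sup norm. -/
def generatorGraph (S : FellerSemigroup d) : Set (C(Config d, ℝ) × C(Config d, ℝ)) :=
  {p | Tendsto (fun t : ℝ≥0 => (t : ℝ)⁻¹ • (S.act t p.1 - p.1)) (𝓝[>] 0) (𝓝 p.2)}

/-- `S` is generated by `𝓛 = gen 𝓑 lam q`: its infinitesimal generator is the closure of `𝓛`
acting on local functions. -/
def IsGeneratedBy (S : FellerSemigroup d) (𝓑 : Set (Finset (Site d)))
    (lam : Finset (Site d) → ℝ) (q : Finset (Site d) → Finset (Site d)) : Prop :=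
  S.generatorGraph =
    closure {p : C(Config d, ℝ) × C(Config d, ℝ) | IsLocal p.1 ∧ p.2 = gen 𝓑 lam q p.1}

/-- Distinct initial probability measures stay distinct at all times. -/
def NonDegenerate (S : FellerSemigroup d) : Prop :=
  ∀ μ ν : Measure (Config d), IsProbabilityMeasure μ → IsProbabilityMeasure ν → μ ≠ ν →
    ∀ t : ℝ≥0, 0 < t → S.evolve t μ ≠ S.evolve t ν

end FellerSemigroup

end SpinFlip

end

/-! Everything is done in the basis of characters σ_A. Flipping a spin multiplies σ_A by ±1, and a
product of characters is the character of the symmetric difference, so 𝓛σ_A is the sum, over B ∈ 𝓑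
and i ∈ A, of -2λ(B) σ_{q(B) ∆ (B+i) ∆ A}. Measure an expansion ∑ c(x) σ_{A(x)} by ∑ |c(x)|
e^{r|A(x)|}. Applying 𝓛 enlarges a set by at most 2|B|, which M = ∑ |λ(B)| e^{u|B|} pays for when 2s
≤ u, and brings in a factor |A|, which is paid for by lowering the rate from r to s. The cost is
2M/(r-s) (`IsExpansion.gen`), the loss of a Cauchy–Kovalevskaya scheme. Sharing the available rate
equally among n applications yields n! κ^n (`HasExpansion.iterate_gen`), hence analyticity of local
functions.

For non-degeneracy, suppose μS(t) = νS(t) and put F_k(s) = ∫ S(s)𝓛^k f d(μ-ν) for local f. Each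
F_{k+1} is the right derivative of F_k, |F_k| is at most a multiple of k! κ^k uniformly in s, and
all F_k vanish on [t, ∞). Taylor's formula propagates the zero backwards by a fixed length at a
time, down to s = 0 (`eq_zero_of_deriv_chain`); density of local functions then gives μ = ν. Since
𝓛^k f need not be local, truncating its expansion is what places it in the domain of the closure
(`IsExpansion.mem_closure`). -/

noncomputable section

namespace SpinFlip

variable {d : ℕ}

open scoped symmDiff

/-! ### Characters σ_A and their gradients -/

section Spin

@[simp] lemma spin_apply (A : Finset (Site d)) (σ : Config d) :
    spin A σ = ∏ i ∈ A, (((σ i : ℤˣ) : ℤ) : ℝ) := rfl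

@[simp] lemma grad_apply (i : Site d) (f : C(Config d, ℝ)) (σ : Config d) :
    grad i f σ = f (flip i σ) - f σ := rfl

lemma flip_apply (i : Site d) (σ : Config d) : flip i σ = Function.update σ i (-σ i) := rfl

@[simp] lemma spin_empty : spin (∅ : Finset (Site d)) = 1 := by
  ext σ
  simp

lemma unit_mul_self (s : ℤˣ) : ((s : ℤ) : ℝ) * ((s : ℤ) : ℝ) = 1 := by
  rcases Int.units_eq_one_or s with rfl | rfl <;> simp

lemma spin_mul_spin (A B : Finset (Site d)) : spin A * spin B = spin (A ∆ B) := by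
  ext σ
  simp only [ContinuousMap.mul_apply, spin_apply]
  rw [← Finset.prod_inter_mul_prod_sdiff A B, ← Finset.prod_inter_mul_prod_sdiff B A,
    Finset.inter_comm B A, symmDiff, Finset.sup_eq_union,
    Finset.prod_union (by exact disjoint_sdiff_sdiff)]
  have h : (∏ i ∈ A ∩ B, (((σ i : ℤˣ) : ℤ) : ℝ)) * (∏ i ∈ A ∩ B, (((σ i : ℤˣ) : ℤ) : ℝ)) = 1 := by
    rw [← Finset.prod_mul_distrib]
    exact Finset.prod_eq_one fun i _ => unit_mul_self _
  linear_combination ((∏ i ∈ A \ B, (((σ i : ℤˣ) : ℤ) : ℝ)) *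
    (∏ i ∈ B \ A, (((σ i : ℤˣ) : ℤ) : ℝ))) * h

lemma norm_spin_le (A : Finset (Site d)) : ‖spin A‖ ≤ 1 := by
  rw [ContinuousMap.norm_le _ zero_le_one]
  intro σ
  rw [spin_apply, norm_prod]
  refine (Finset.prod_eq_one fun i _ => ?_).le
  rcases Int.units_eq_one_or (σ i) with h | h <;> simp [h]

lemma card_symmDiff_le (A B : Finset (Site d)) : (A ∆ B).card ≤ A.card + B.card := by
  rw [symmDiff, Finset.sup_eq_union]
  exact (Finset.card_union_le _ _).trans
    (add_le_add (Finset.card_le_card Finset.sdiff_subset) (Finset.card_le_card Finset.sdiff_subset))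

@[simp] lemma card_shift (B : Finset (Site d)) (i : Site d) : (shift B i).card = B.card :=
  Finset.card_map _

lemma grad_spin (i : Site d) (A : Finset (Site d)) :
    grad i (spin A) = (if i ∈ A then (-2 : ℝ) else 0) • spin A := by
  ext σ
  simp only [grad_apply, ContinuousMap.smul_apply, spin_apply, smul_eq_mul, flip_apply]
  split_ifs with h
  · rw [← Finset.mul_prod_erase A _ h, ← Finset.mul_prod_erase A _ h,
      Finset.prod_congr rfl (g := fun j => (((σ j : ℤˣ) : ℤ) : ℝ))]
    · simp
      ring
    · intro j hj
      rw [Function.update_of_ne (Finset.ne_of_mem_erase hj)]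
  · rw [Finset.prod_congr rfl (g := fun j => (((σ j : ℤˣ) : ℤ) : ℝ))]
    · simp
    · intro j hj
      rw [Function.update_of_ne (by rintro rfl; exact h hj)]

/-- The discrete gradient as a continuous linear map. -/
def gradL (i : Site d) : C(Config d, ℝ) →L[ℝ] C(Config d, ℝ) where
  toFun := grad i
  map_add' f g := by ext σ; simp; ring
  map_smul' a f := by ext σ; simp; ring
  cont := (ContinuousMap.continuous_precomp (flip i)).sub continuous_id

@[simp] lemma gradL_apply (i : Site d) (f : C(Config d, ℝ)) : gradL i f = grad i f := rfl

end Spin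

/-! ### Local functions: density and expansion in characters -/

section Local

lemma isLocal_const (a : ℝ) : IsLocal (ContinuousMap.const (Config d) a) :=
  ⟨∅, fun _ _ _ => rfl⟩

lemma isLocal_spin (A : Finset (Site d)) : IsLocal (spin A) := by
  refine ⟨A, fun σ τ h => ?_⟩
  rw [spin_apply, spin_apply]
  exact Finset.prod_congr rfl fun i hi => by rw [h i hi]

lemma IsLocal.map₂ {f g h : C(Config d, ℝ)} (hf : IsLocal f) (hg : IsLocal g)
    (op : ℝ → ℝ → ℝ) (hh : ∀ σ, h σ = op (f σ) (g σ)) : IsLocal h := by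
  obtain ⟨Λ, hΛ⟩ := hf
  obtain ⟨Λ', hΛ'⟩ := hg
  refine ⟨Λ ∪ Λ', fun σ τ hστ => ?_⟩
  rw [hh, hh, hΛ fun i hi => hστ i (by simp_all), hΛ' fun i hi => hστ i (by simp_all)]

/-- The algebra of local functions. -/
def localAlgebra (d : ℕ) : Subalgebra ℝ C(Config d, ℝ) where
  carrier := {f | IsLocal f}
  mul_mem' hf hg := hf.map₂ hg (· * ·) fun _ => rfl
  add_mem' hf hg := hf.map₂ hg (· + ·) fun _ => rfl
  algebraMap_mem' := isLocal_const

lemma localAlgebra_separatesPoints : (localAlgebra d).SeparatesPoints := by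
  intro σ τ hne
  obtain ⟨i, hi⟩ := Function.ne_iff.1 hne
  refine ⟨spin {i}, ⟨spin {i}, isLocal_spin _, rfl⟩, ?_⟩
  simpa [Units.ext_iff] using hi

/-- Stone–Weierstrass: the single spins σ_i already separate points. -/
lemma dense_isLocal : Dense {f : C(Config d, ℝ) | IsLocal f} := by
  have h := ContinuousMap.subalgebra_topologicalClosure_eq_top_of_separatesPoints _
    (localAlgebra_separatesPoints (d := d))
  rw [dense_iff_closure_eq]
  exact congrArg (fun A : Subalgebra ℝ C(Config d, ℝ) => (A : Set C(Config d, ℝ))) h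

/-- Local functions are linear combinations of the functions `spin A`. -/
lemma IsLocal.mem_span {f : C(Config d, ℝ)} (hf : IsLocal f) :
    f ∈ Submodule.span ℝ (Set.range (spin (d := d))) := by
  obtain ⟨Λ, hΛ⟩ := hf
  induction Λ using Finset.induction_on generalizing f with
  | empty =>
    have : f = f 1 • spin ∅ := by
      ext σ
      simpa using hΛ (by simp : ∀ i ∈ ((∅ : Finset (Site d)) : Set (Site d)), σ i = (1 : Config d) i)
    rw [this]
    exact Submodule.smul_mem _ _ (Submodule.subset_span ⟨∅, rfl⟩)
  | insert i Λ hi ih =>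
    have hup : ∀ (σ τ : Config d) (s : ℤˣ), (∀ j ∈ (Λ : Set (Site d)), σ j = τ j) →
        f (Function.update σ i s) = f (Function.update τ i s) := by
      intro σ τ s h
      refine hΛ fun j hj => ?_
      by_cases hji : j = i
      · subst hji
        simp
      · rw [Function.update_of_ne hji, Function.update_of_ne hji]
        refine h j ?_
        simpa [hji] using hj
    have hσ : ∀ σ : Config d, (f σ = f (Function.update σ i 1) ∧
        f (flip i σ) = f (Function.update σ i (-1)) ∧ σ i = 1) ∨
        (f σ = f (Function.update σ i (-1)) ∧
        f (flip i σ) = f (Function.update σ i 1) ∧ σ i = -1) := by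
      intro σ
      rcases Int.units_eq_one_or (σ i) with h | h
      · left
        refine ⟨?_, ?_, h⟩
        · conv_lhs => rw [← Function.update_eq_self i σ, h]
        · rw [flip_apply, h]
      · right
        refine ⟨?_, ?_, h⟩
        · conv_lhs => rw [← Function.update_eq_self i σ, h]
        · rw [flip_apply, h, neg_neg]
    -- The part of f even in the spin at i does not depend on that spin. The odd part, treated next,
    -- loses its dependence after multiplication by σ_i, and σ_i² = 1 undoes this.
    have h1 : (f + f.comp (flip i)) ∈ Submodule.span ℝ (Set.range (spin (d := d))) := by
      refine ih fun σ τ h => ?_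
      have e1 := hup σ τ 1 h
      have e2 := hup σ τ (-1) h
      simp only [ContinuousMap.coe_add, Pi.add_apply, ContinuousMap.comp_apply]
      rcases hσ σ with ⟨a1, a2, -⟩ | ⟨a1, a2, -⟩ <;> rcases hσ τ with ⟨b1, b2, -⟩ | ⟨b1, b2, -⟩ <;>
        rw [a1, a2, b1, b2, e1, e2] <;> ring
    have h2 : (spin {i} * (f - f.comp (flip i))) ∈
        Submodule.span ℝ (Set.range (spin (d := d))) := by
      refine ih fun σ τ h => ?_
      have e1 := hup σ τ 1 h
      have e2 := hup σ τ (-1) h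
      simp only [ContinuousMap.coe_mul, ContinuousMap.coe_sub, Pi.mul_apply, Pi.sub_apply,
        ContinuousMap.comp_apply, spin_apply, Finset.prod_singleton]
      rcases hσ σ with ⟨a1, a2, a3⟩ | ⟨a1, a2, a3⟩ <;>
        rcases hσ τ with ⟨b1, b2, b3⟩ | ⟨b1, b2, b3⟩ <;>
        rw [a1, a2, a3, b1, b2, b3, e1, e2] <;> push_cast <;> ring
    have h3 : spin {i} * (spin {i} * (f - f.comp (flip i))) ∈
        Submodule.span ℝ (Set.range (spin (d := d))) := by
      have := Submodule.mem_map_of_mem (f := LinearMap.mulLeft ℝ (spin {i})) h2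
      rw [Submodule.map_span] at this
      refine Submodule.span_mono ?_ this
      rintro _ ⟨_, ⟨A, rfl⟩, rfl⟩
      exact ⟨_, (spin_mul_spin _ _).symm⟩
    rw [← mul_assoc, spin_mul_spin, symmDiff_self, Finset.bot_eq_empty, spin_empty, one_mul] at h3
    have : f = (2⁻¹ : ℝ) • ((f + f.comp (flip i)) + (f - f.comp (flip i))) := by
      ext σ
      simp
      ring
    rw [this]
    exact Submodule.smul_mem _ _ (Submodule.add_mem _ h1 h3)

end Local

end SpinFlip

end

noncomputable section

namespace SpinFlip

variable {d : ℕ}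

open scoped symmDiff

/-! ### Exponentially weighted expansions and the action of the generator -/

section Expansion

variable {ι : Type} {c : ι → ℝ} {A : ι → Finset (Site d)} {r s : ℝ} {g : C(Config d, ℝ)}

/-- `g = ∑_x c(x) σ_{A(x)}`, where the coefficients decay exponentially, at the rate `r`, in the
size of the sets. -/
structure IsExpansion (c : ι → ℝ) (A : ι → Finset (Site d)) (r : ℝ) (g : C(Config d, ℝ)) :
    Prop where
  summable : Summable fun x => |c x| * Real.exp (r * (A x).card)
  hasSum : HasSum (fun x => c x • spin (A x)) g

/-- The exponentially weighted `ℓ¹` norm of the coefficients of an expansion. -/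
def weight (c : ι → ℝ) (A : ι → Finset (Site d)) (r : ℝ) : ℝ :=
  ∑' x, |c x| * Real.exp (r * (A x).card)

lemma weight_nonneg : 0 ≤ weight c A r := tsum_nonneg fun _ => by positivity

lemma abs_le_weightTerm (hr : 0 ≤ r) (x : ι) : |c x| ≤ |c x| * Real.exp (r * (A x).card) :=
  le_mul_of_one_le_right (abs_nonneg _) (Real.one_le_exp (by positivity))

lemma norm_smul_spin_le (hr : 0 ≤ r) (x : ι) :
    ‖c x • spin (A x)‖ ≤ |c x| * Real.exp (r * (A x).card) := by
  rw [norm_smul, Real.norm_eq_abs]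
  exact (mul_le_of_le_one_right (abs_nonneg _) (norm_spin_le _)).trans (abs_le_weightTerm hr x)

lemma IsExpansion.norm_le (h : IsExpansion c A r g) (hr : 0 ≤ r) : ‖g‖ ≤ weight c A r := by
  rw [← h.hasSum.tsum_eq]
  exact tsum_of_norm_bounded h.summable.hasSum (norm_smul_spin_le hr)

/-- The coefficients of the gradients of an expansion, weighted at the rate `s`. -/
def gradWeight (c : ι → ℝ) (A : ι → Finset (Site d)) (s : ℝ) (p : Site d × ι) : ℝ :=
  (if p.1 ∈ A p.2 then 2 else 0) * (|c p.2| * Real.exp (s * (A p.2).card))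

lemma gradWeight_nonneg (p : Site d × ι) : 0 ≤ gradWeight c A s p := by
  unfold gradWeight
  positivity

/-- Summing over i produces 2|A|, and x ≤ e^x at x = (r-s)|A| trades |A| for the drop in rate. -/
lemma summable_gradWeight (h : Summable fun x => |c x| * Real.exp (r * (A x).card)) (hs : s < r) :
    Summable (gradWeight c A s) ∧ ∑' p, gradWeight c A s p ≤ 2 / (r - s) * weight c A r := by
  have hrs : 0 < r - s := sub_pos.2 hs
  have hx : ∀ x, HasSum (fun i => gradWeight c A s (i, x))
      ((A x).card * 2 * (|c x| * Real.exp (s * (A x).card))) := by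
    intro x
    have := hasSum_sum_of_ne_finset_zero (L := .unconditional _) (f := fun i => gradWeight c A s (i, x)) (s := A x)
      (fun i hi => by simp [gradWeight, hi])
    convert this using 1
    rw [Finset.sum_congr rfl (g := fun _ => 2 * (|c x| * Real.exp (s * (A x).card)))
      (fun i hi => by simp [gradWeight, hi])]
    simp [mul_assoc]
  have hle : ∀ x, (A x).card * 2 * (|c x| * Real.exp (s * (A x).card)) ≤
      2 / (r - s) * (|c x| * Real.exp (r * (A x).card)) := by
    intro x
    have h1 : (r - s) * (A x).card ≤ Real.exp ((r - s) * (A x).card) := by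
      have := Real.add_one_le_exp ((r - s) * (A x).card)
      linarith
    have h2 : Real.exp (r * (A x).card) =
        Real.exp ((r - s) * (A x).card) * Real.exp (s * (A x).card) := by
      rw [← Real.exp_add]
      ring_nf
    rw [h2, div_mul_eq_mul_div, le_div_iff₀ hrs]
    have h3 : 0 ≤ 2 * |c x| * Real.exp (s * (A x).card) := by positivity
    nlinarith [mul_le_mul_of_nonneg_left h1 h3]
  have hsum : Summable fun x => ((A x).card * 2 * (|c x| * Real.exp (s * (A x).card)) : ℝ) :=
    Summable.of_nonneg_of_le (fun x => by positivity) hle (h.mul_left _)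
  -- For fixed x the sum over i is finite and explicit, so it is taken first.
  have hswap : Summable fun p : ι × Site d => gradWeight c A s p.swap := by
    rw [summable_prod_of_nonneg fun p => gradWeight_nonneg _]
    refine ⟨fun x => (hx x).summable, ?_⟩
    simpa only [Prod.swap_prod_mk, (hx _).tsum_eq] using hsum
  refine ⟨(Equiv.prodComm ι (Site d)).summable_iff.1 hswap, ?_⟩
  rw [← (Equiv.prodComm ι (Site d)).tsum_eq]
  change ∑' p : ι × Site d, gradWeight c A s p.swap ≤ _
  rw [hswap.tsum_prod]
  simp only [Prod.swap_prod_mk, (hx _).tsum_eq]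
  rw [weight, ← tsum_mul_left]
  exact hsum.tsum_le_tsum hle (h.mul_left _)

lemma norm_grad_term_le (hs : 0 ≤ s) (i : Site d) (x : ι) :
    ‖c x • grad i (spin (A x))‖ ≤ gradWeight c A s (i, x) := by
  rw [grad_spin, smul_comm, norm_smul, gradWeight]
  refine mul_le_mul (le_of_eq ?_) (norm_smul_spin_le hs x) (norm_nonneg _) (by positivity)
  split_ifs <;> simp

lemma IsExpansion.hasSum_grad (h : IsExpansion c A r g) (i : Site d) :
    HasSum (fun x => c x • grad i (spin (A x))) (grad i g) := by
  simpa using (gradL i).hasSum h.hasSum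

lemma IsExpansion.summable_norm_grad (h : IsExpansion c A r g) (hr : 0 < r) :
    Summable fun i => ‖grad i g‖ := by
  have hP := (summable_gradWeight h.summable hr).1
  refine Summable.of_nonneg_of_le (fun _ => norm_nonneg _) (fun i => ?_) hP.prod
  rw [← (h.hasSum_grad i).tsum_eq]
  exact tsum_of_norm_bounded (hP.prod_factor i).hasSum (norm_grad_term_le le_rfl i)

lemma norm_spin_mul_le (A : Finset (Site d)) (f : C(Config d, ℝ)) : ‖spin A * f‖ ≤ ‖f‖ :=
  (norm_mul_le _ _).trans (mul_le_of_le_one_left (norm_nonneg _) (norm_spin_le A))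

/-- The double series is dominated by `gradWeight` at rate 0, so it may be summed over x first,
which recovers the defining series over i. -/
lemma IsExpansion.hasSum_blockGen (h : IsExpansion c A r g) (hr : 0 < r) (B : Finset (Site d)) :
    HasSum (fun p : Site d × ι => spin (shift B p.1) * c p.2 • grad p.1 (spin (A p.2)))
      (blockGen B g) := by
  have hU : Summable fun p : Site d × ι =>
      spin (shift B p.1) * c p.2 • grad p.1 (spin (A p.2)) :=
    Summable.of_norm_bounded (summable_gradWeight h.summable hr).1 fun p =>
      (norm_spin_mul_le _ _).trans (norm_grad_term_le le_rfl p.1 p.2)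
  convert hU.hasSum using 1
  rw [hU.tsum_prod, blockGen]
  exact tsum_congr fun i => ((h.hasSum_grad i).mul_left _).tsum_eq.symm

lemma norm_blockGen_le {f : C(Config d, ℝ)} (hf : Summable fun i => ‖grad i f‖)
    (B : Finset (Site d)) : ‖blockGen B f‖ ≤ ∑' i, ‖grad i f‖ :=
  tsum_of_norm_bounded hf.hasSum fun _ => norm_spin_mul_le _ _

section Generator

variable {𝓑 : Set (Finset (Site d))} {lam : Finset (Site d) → ℝ}
  {q : Finset (Site d) → Finset (Site d)} {u : ℝ}

lemma IsExpansion.inDomain (h : IsExpansion c A r g) (hr : 0 < r)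
    (hlam : Summable fun B : 𝓑 => |lam B|) : InDomain 𝓑 lam q g := by
  refine ⟨h.summable_norm_grad hr, ?_⟩
  refine Summable.of_nonneg_of_le (fun _ => norm_nonneg _) (fun B => ?_)
    (hlam.mul_right (∑' i, ‖grad i g‖))
  rw [norm_smul, Real.norm_eq_abs]
  exact mul_le_mul_of_nonneg_left ((norm_spin_mul_le _ _).trans
    (norm_blockGen_le (h.summable_norm_grad hr) _)) (abs_nonneg _)

/-- The coefficients of the expansion of `gen 𝓑 lam q g`. -/
def genCoeff (𝓑 : Set (Finset (Site d))) (lam : Finset (Site d) → ℝ) (c : ι → ℝ)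
    (A : ι → Finset (Site d)) (p : 𝓑 × (Site d × ι)) : ℝ :=
  lam p.1 * (c p.2.2 * if p.2.1 ∈ A p.2.2 then -2 else 0)

/-- The sets in the expansion of `gen 𝓑 lam q g`. -/
def genSet (𝓑 : Set (Finset (Site d))) (q : Finset (Site d) → Finset (Site d))
    (A : ι → Finset (Site d)) (p : 𝓑 × (Site d × ι)) : Finset (Site d) :=
  (q p.1 ∆ shift p.1 p.2.1) ∆ A p.2.2

lemma genCoeff_smul_spin (p : 𝓑 × (Site d × ι)) :
    genCoeff 𝓑 lam c A p • spin (genSet 𝓑 q A p) =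
      lam p.1 • (spin (q p.1) *
        (spin (shift p.1 p.2.1) * c p.2.2 • grad p.2.1 (spin (A p.2.2)))) := by
  rw [genCoeff, genSet, ← spin_mul_spin, ← spin_mul_spin, grad_spin]
  simp only [mul_smul_comm, smul_smul, mul_assoc]

lemma abs_genCoeff (p : 𝓑 × (Site d × ι)) :
    |genCoeff 𝓑 lam c A p| = |lam p.1| * gradWeight c A 0 p.2 := by
  rw [genCoeff, gradWeight, abs_mul, abs_mul]
  split_ifs <;> simp [mul_comm]

/-- The new set has at most |q(B)| + |B| + |A| ≤ 2|B| + |A| elements; this is where 2s ≤ u comes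
from. -/
lemma genCoeff_weight_le (hq : ∀ B, (q B).card ≤ B.card) (hs : 0 ≤ s) (hsu : 2 * s ≤ u)
    (p : 𝓑 × (Site d × ι)) :
    |genCoeff 𝓑 lam c A p| * Real.exp (s * (genSet 𝓑 q A p).card) ≤
      (|lam p.1| * Real.exp (u * (p.1 : Finset (Site d)).card)) * gradWeight c A s p.2 := by
  have hcard : ((genSet 𝓑 q A p).card : ℝ) ≤
      2 * (p.1 : Finset (Site d)).card + (A p.2.2).card := by
    have h1 := card_symmDiff_le (q p.1 ∆ shift p.1 p.2.1) (A p.2.2)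
    have h2 := card_symmDiff_le (q p.1) (shift p.1 p.2.1)
    have h3 := hq p.1
    rw [card_shift] at h2
    have : (genSet 𝓑 q A p).card ≤ 2 * (p.1 : Finset (Site d)).card + (A p.2.2).card := by
      unfold genSet
      omega
    exact_mod_cast this
  have hexp : Real.exp (s * (genSet 𝓑 q A p).card) ≤
      Real.exp (u * (p.1 : Finset (Site d)).card) * Real.exp (s * (A p.2.2).card) := by
    rw [← Real.exp_add]
    refine Real.exp_le_exp.2 ?_
    have h1 := mul_le_mul_of_nonneg_left hcard hs
    have h2 := mul_le_mul_of_nonneg_right hsu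
      (Nat.cast_nonneg (α := ℝ) (p.1 : Finset (Site d)).card)
    linarith
  have hg : gradWeight c A s p.2 = gradWeight c A 0 p.2 * Real.exp (s * (A p.2.2).card) := by
    simp [gradWeight, mul_assoc]
  rw [abs_genCoeff, hg]
  calc _ ≤ (|lam p.1| * gradWeight c A 0 p.2) *
        (Real.exp (u * (p.1 : Finset (Site d)).card) * Real.exp (s * (A p.2.2).card)) :=
        mul_le_mul_of_nonneg_left hexp (mul_nonneg (abs_nonneg _) (gradWeight_nonneg _))
    _ = _ := by ring

lemma IsExpansion.summable_genCoeff (h : IsExpansion c A r g) (hr : 0 < r)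
    (hlam : Summable fun B : 𝓑 => |lam B|) : Summable fun p => |genCoeff 𝓑 lam c A p| := by
  simp only [abs_genCoeff]
  exact hlam.mul_of_nonneg (summable_gradWeight h.summable hr).1 (fun _ => abs_nonneg _)
    gradWeight_nonneg

lemma IsExpansion.hasSum_gen (h : IsExpansion c A r g) (hr : 0 < r)
    (hlam : Summable fun B : 𝓑 => |lam B|) :
    HasSum (fun p => genCoeff 𝓑 lam c A p • spin (genSet 𝓑 q A p)) (gen 𝓑 lam q g) := by
  have hT : Summable fun p => genCoeff 𝓑 lam c A p • spin (genSet 𝓑 q A p) := by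
    refine Summable.of_norm_bounded (h.summable_genCoeff hr hlam) fun p => ?_
    rw [norm_smul, Real.norm_eq_abs]
    exact mul_le_of_le_one_right (abs_nonneg _) (norm_spin_le _)
  convert hT.hasSum using 1
  rw [hT.tsum_prod, gen]
  refine tsum_congr fun B => ?_
  simp only [genCoeff_smul_spin]
  exact (((h.hasSum_blockGen hr B).mul_left _).const_smul _).tsum_eq.symm

lemma IsExpansion.gen (h : IsExpansion c A r g) (hq : ∀ B, (q B).card ≤ B.card) (hs : 0 ≤ s)
    (hsu : 2 * s ≤ u) (hsr : s < r)
    (hlam : Summable fun B : 𝓑 => |lam B| * Real.exp (u * (B : Finset (Site d)).card))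
    (hlam' : Summable fun B : 𝓑 => |lam B|) :
    IsExpansion (genCoeff 𝓑 lam c A) (genSet 𝓑 q A) s (gen 𝓑 lam q g) ∧
      weight (genCoeff 𝓑 lam c A) (genSet 𝓑 q A) s ≤
        2 * (∑' B : 𝓑, |lam B| * Real.exp (u * (B : Finset (Site d)).card)) / (r - s) *
          weight c A r := by
  have hP := summable_gradWeight h.summable hsr
  have hprod := hlam.mul_of_nonneg hP.1 (fun _ => by positivity) gradWeight_nonneg
  have hle := genCoeff_weight_le (c := c) (A := A) (𝓑 := 𝓑) (lam := lam) hq hs hsu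
  have hsum := Summable.of_nonneg_of_le (fun _ => by positivity) hle hprod
  refine ⟨⟨hsum, h.hasSum_gen (hs.trans_lt hsr) hlam'⟩, ?_⟩
  calc _ ≤ _ := hsum.tsum_le_tsum hle hprod
    _ = _ := (hlam.tsum_mul_tsum hP.1 hprod).symm
    _ ≤ _ := mul_le_mul_of_nonneg_left hP.2 (tsum_nonneg fun _ => by positivity)
    _ = _ := by ring

/-- A function with an exponentially decaying expansion lies in the domain of the closure of `gen`
restricted to local functions. -/
lemma IsExpansion.mem_closure (h : IsExpansion c A r g) (hr : 0 < r)
    (hlam : Summable fun B : 𝓑 => |lam B|) :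
    (g, SpinFlip.gen 𝓑 lam q g) ∈ closure {p : C(Config d, ℝ) × C(Config d, ℝ) |
      IsLocal p.1 ∧ p.2 = SpinFlip.gen 𝓑 lam q p.1} := by
  classical
  -- Truncation sets coefficients to zero but keeps the index type, so all the truncated series for
  -- the generator share one dominating series.
  let cF : Finset ι → ι → ℝ := fun F x => if x ∈ F then c x else 0
  have habs : ∀ F x, |cF F x| ≤ |c x| := by
    intro F x
    simp only [cF]
    split_ifs <;> simp
  have hF : ∀ F, IsExpansion (cF F) A r (∑ x ∈ F, c x • spin (A x)) := by
    intro F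
    refine ⟨Summable.of_nonneg_of_le (fun _ => by positivity)
      (fun x => mul_le_mul_of_nonneg_right (habs F x) (Real.exp_nonneg _)) h.summable, ?_⟩
    have := hasSum_sum_of_ne_finset_zero (L := .unconditional _) (f := fun x => cF F x • spin (A x)) (s := F)
      (fun x hx => by simp [cF, hx])
    rwa [Finset.sum_congr rfl (g := fun x => c x • spin (A x))
      (fun x hx => by simp [cF, hx])] at this
  refine mem_closure_of_tendsto (b := (atTop : Filter (Finset ι)))
    (f := fun F => (∑ x ∈ F, c x • spin (A x),
      SpinFlip.gen 𝓑 lam q (∑ x ∈ F, c x • spin (A x)))) ?_ ?_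
  · refine Tendsto.prodMk_nhds h.hasSum ?_
    simp only [← ((hF _).hasSum_gen hr hlam).tsum_eq, ← (h.hasSum_gen hr hlam).tsum_eq]
    refine tendsto_tsum_of_dominated_convergence (h.summable_genCoeff hr hlam) (fun p => ?_)
      (Eventually.of_forall fun F p => ?_)
    -- Each single term is eventually constant: it is untouched once F contains its index.
    · refine tendsto_const_nhds.congr' ?_
      filter_upwards [eventually_ge_atTop {p.2.2}] with F hF
      have : p.2.2 ∈ F := hF (Finset.mem_singleton_self _)
      simp [genCoeff, cF, this]
    · rw [norm_smul, Real.norm_eq_abs]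
      refine (mul_le_of_le_one_right (abs_nonneg _) (norm_spin_le _)).trans ?_
      rw [genCoeff, genCoeff, abs_mul, abs_mul, abs_mul, abs_mul]
      exact mul_le_mul_of_nonneg_left
        (mul_le_mul_of_nonneg_right (habs _ _) (abs_nonneg _)) (abs_nonneg _)
  · refine Eventually.of_forall fun F => ⟨?_, rfl⟩
    exact Subalgebra.sum_mem (localAlgebra d) fun x _ =>
      Subalgebra.smul_mem (localAlgebra d) (isLocal_spin (A x)) _

end Generator

end Expansion

end SpinFlip

end

noncomputable section

namespace SpinFlip

variable {d : ℕ}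

/-! ### Factorial bounds on the powers of the generator -/

section PowerBounds

variable {𝓑 : Set (Finset (Site d))} {lam : Finset (Site d) → ℝ}
  {q : Finset (Site d) → Finset (Site d)} {u : ℝ}

/-- Group the sets by cardinality. In `ℝ≥0∞` the regrouping needs no prior summability. -/
lemma summable_lam_exp {c : ℝ} {ψ : ℕ → ℝ≥0}
    (hlam : ∀ k : ℕ, ∑' B : {B : Finset (Site d) // B ∈ 𝓑 ∧ B.card = k},
      ENNReal.ofReal |lam B| ≤ ENNReal.ofReal (c * ψ k))
    (hψ : Summable fun k : ℕ => Real.exp (u * k) * (ψ k : ℝ)) :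
    Summable fun B : 𝓑 => |lam B| * Real.exp (u * (B : Finset (Site d)).card) := by
  have hfin : ∑' B : 𝓑, ENNReal.ofReal (|lam B| * Real.exp (u * (B : Finset (Site d)).card)) ≠ ∞ := by
    have hbound : ∑' B : 𝓑,
        ENNReal.ofReal (|lam B| * Real.exp (u * (B : Finset (Site d)).card)) ≤
        ∑' k : ℕ, ENNReal.ofReal (|c| * (Real.exp (u * k) * (ψ k : ℝ))) := by
      rw [← (Equiv.sigmaFiberEquiv fun B : 𝓑 => (B : Finset (Site d)).card).tsum_eq,
        ENNReal.tsum_sigma']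
      refine ENNReal.tsum_le_tsum fun k => ?_
      have hterm : ∀ B : {B : 𝓑 // (B : Finset (Site d)).card = k},
          ENNReal.ofReal (|lam B.1| * Real.exp (u * (B.1 : Finset (Site d)).card)) =
            ENNReal.ofReal |lam B.1| * ENNReal.ofReal (Real.exp (u * k)) := by
        rintro ⟨B, hB⟩
        rw [ENNReal.ofReal_mul (abs_nonneg _), hB]
      calc ∑' B : {B : 𝓑 // (B : Finset (Site d)).card = k},
            ENNReal.ofReal (|lam B.1| * Real.exp (u * (B.1 : Finset (Site d)).card))
          = (∑' B : {B : 𝓑 // (B : Finset (Site d)).card = k}, ENNReal.ofReal |lam B.1|) *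
              ENNReal.ofReal (Real.exp (u * k)) := by
            simp only [hterm, ENNReal.tsum_mul_right]
        _ = (∑' B : {B : Finset (Site d) // B ∈ 𝓑 ∧ B.card = k}, ENNReal.ofReal |lam B|) *
              ENNReal.ofReal (Real.exp (u * k)) := by
            rw [← (Equiv.subtypeSubtypeEquivSubtypeInter (· ∈ 𝓑)
              (fun B : Finset (Site d) => B.card = k)).tsum_eq]
            rfl
        _ ≤ ENNReal.ofReal (c * ψ k) * ENNReal.ofReal (Real.exp (u * k)) := by
            gcongr
            exact hlam k
        _ ≤ ENNReal.ofReal (|c| * ψ k) * ENNReal.ofReal (Real.exp (u * k)) := by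
            gcongr
            exact le_abs_self c
        _ = ENNReal.ofReal (|c| * (Real.exp (u * k) * (ψ k : ℝ))) := by
            rw [← ENNReal.ofReal_mul (by positivity)]
            ring_nf
    exact ne_top_of_le_ne_top (hψ.mul_left |c|).tsum_ofReal_ne_top hbound
  have := ENNReal.summable_toReal hfin
  refine this.congr fun B => ?_
  exact (ENNReal.toReal_ofReal (by positivity))

lemma summable_lam (hu : 0 ≤ u)
    (hlam : Summable fun B : 𝓑 => |lam B| * Real.exp (u * (B : Finset (Site d)).card)) :
    Summable fun B : 𝓑 => |lam B| :=
  hlam.of_nonneg_of_le (fun _ => abs_nonneg _) fun _ =>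
    le_mul_of_one_le_right (abs_nonneg _) (Real.one_le_exp (by positivity))

/-- `g` has an expansion whose coefficients have a weighted norm of at most `K` at the rate `r`. -/
def HasExpansion (r K : ℝ) (g : C(Config d, ℝ)) : Prop :=
  ∃ (ι : Type) (c : ι → ℝ) (A : ι → Finset (Site d)), IsExpansion c A r g ∧ weight c A r ≤ K

lemma HasExpansion.nonneg {r K : ℝ} {g : C(Config d, ℝ)} (h : HasExpansion r K g) : 0 ≤ K := by
  obtain ⟨ι, c, A, -, h⟩ := h
  exact weight_nonneg.trans h

lemma HasExpansion.mono {r K K' : ℝ} {g : C(Config d, ℝ)} (h : HasExpansion r K g)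
    (hK : K ≤ K') : HasExpansion r K' g := by
  obtain ⟨ι, c, A, h, hw⟩ := h
  exact ⟨ι, c, A, h, hw.trans hK⟩

lemma HasExpansion.norm_le {r K : ℝ} {g : C(Config d, ℝ)} (h : HasExpansion r K g) (hr : 0 ≤ r) :
    ‖g‖ ≤ K := by
  obtain ⟨ι, c, A, h, hw⟩ := h
  exact (h.norm_le hr).trans hw

/-- Each application changes the index type of the expansion; hiding that type in an existential
makes the step iterable. -/
lemma HasExpansion.gen {r s K : ℝ} {g : C(Config d, ℝ)} (h : HasExpansion r K g)
    (hq : ∀ B, (q B).card ≤ B.card) (hu : 0 ≤ u) (hs : 0 ≤ s) (hsu : 2 * s ≤ u) (hsr : s < r)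
    (hlam : Summable fun B : 𝓑 => |lam B| * Real.exp (u * (B : Finset (Site d)).card)) :
    HasExpansion s
      (2 * (∑' B : 𝓑, |lam B| * Real.exp (u * (B : Finset (Site d)).card)) / (r - s) * K)
      (gen 𝓑 lam q g) := by
  obtain ⟨ι, c, A, h, hw⟩ := h
  have hstep := h.gen hq hs hsu hsr hlam (summable_lam hu hlam)
  refine ⟨_, _, _, hstep.1, hstep.2.trans ?_⟩
  refine mul_le_mul_of_nonneg_left hw (div_nonneg (mul_nonneg zero_le_two ?_) (sub_pos.2 hsr).le)
  exact tsum_nonneg fun _ => by positivity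

lemma HasExpansion.iterate_gen_sub {r δ K : ℝ} {g : C(Config d, ℝ)} (h : HasExpansion r K g)
    (hq : ∀ B, (q B).card ≤ B.card) (hu : 0 ≤ u) (hru : 2 * r ≤ u) (hδ : 0 < δ)
    (hlam : Summable fun B : 𝓑 => |lam B| * Real.exp (u * (B : Finset (Site d)).card))
    (n : ℕ) (hn : n * δ ≤ r) :
    HasExpansion (r - n * δ)
      ((2 * (∑' B : 𝓑, |lam B| * Real.exp (u * (B : Finset (Site d)).card)) / δ) ^ n * K)
      ((SpinFlip.gen 𝓑 lam q)^[n] g) := by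
  induction n with
  | zero => simpa using h
  | succ n ih =>
    push_cast at hn ⊢
    have hnδ : (0 : ℝ) ≤ n * δ := by positivity
    have := (ih (by linarith)).gen (s := r - (n + 1) * δ) hq hu (by linarith) (by linarith)
      (by linarith) hlam
    rw [Function.iterate_succ_apply']
    convert this using 1
    rw [show r - n * δ - (r - (n + 1) * δ) = δ by ring, pow_succ]
    ring

/-- Compare one term of the exponential series, (n+1)^n / n!, with its sum e^{n+1}. -/
lemma add_one_pow_le (n : ℕ) : ((n : ℝ) + 1) ^ n ≤ Real.exp 1 * (n ! : ℝ) * Real.exp 1 ^ n := by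
  have h := Real.pow_div_factorial_le_exp ((n : ℝ) + 1) (by positivity) n
  rw [div_le_iff₀ (by positivity), Real.exp_add, ← Real.exp_one_pow] at h
  linarith

/-- The Cauchy–Kovalevskaya type estimate for the powers of the generator. -/
lemma HasExpansion.iterate_gen {r K : ℝ} {g : C(Config d, ℝ)} (h : HasExpansion r K g)
    (hq : ∀ B, (q B).card ≤ B.card) (hr : 0 < r) (hru : 2 * r ≤ u)
    (hlam : Summable fun B : 𝓑 => |lam B| * Real.exp (u * (B : Finset (Site d)).card)) (n : ℕ) :
    HasExpansion (r / (n + 1))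
      (K * Real.exp 1 * (n ! : ℝ) * (2 *
        (∑' B : 𝓑, |lam B| * Real.exp (u * (B : Finset (Site d)).card)) / r * Real.exp 1) ^ n)
      ((SpinFlip.gen 𝓑 lam q)^[n] g) := by
  have hn : (0 : ℝ) < n + 1 := by positivity
  -- The loss per step is r/(n+1) rather than r/n, so that a positive rate survives n steps;
  -- membership in the domain needs it.
  have key := h.iterate_gen_sub hq (by linarith) hru (div_pos hr hn) hlam n (by
    rw [mul_div_assoc', div_le_iff₀ hn]
    nlinarith)
  rw [show r - n * (r / (n + 1)) = r / (n + 1) by field_simp; ring] at key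
  refine key.mono ?_
  set M := ∑' B : 𝓑, |lam B| * Real.exp (u * (B : Finset (Site d)).card)
  have hM : 0 ≤ M := tsum_nonneg fun _ => by positivity
  have e : 2 * M / (r / (n + 1)) = (2 * M / r) * (n + 1) := by field_simp
  rw [e, mul_pow, mul_pow]
  have h1 := add_one_pow_le n
  have h2 : 0 ≤ (2 * M / r) ^ n * K := mul_nonneg (by positivity) h.nonneg
  calc _ = (2 * M / r) ^ n * K * ((n : ℝ) + 1) ^ n := by ring
    _ ≤ (2 * M / r) ^ n * K * (Real.exp 1 * (n ! : ℝ) * Real.exp 1 ^ n) :=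
      mul_le_mul_of_nonneg_left h1 h2
    _ = _ := by ring

lemma IsLocal.hasExpansion {f : C(Config d, ℝ)} (hf : IsLocal f) (r : ℝ) :
    ∃ K, HasExpansion r K f := by
  obtain ⟨c, hc⟩ := Finsupp.mem_span_range_iff_exists_finsupp.1 hf.mem_span
  refine ⟨_, Finset (Site d), c, id, ⟨?_, ?_⟩, le_rfl⟩
  · exact summable_of_ne_finset_zero (s := c.support) fun A hA => by
      simp [Finsupp.notMem_support_iff.1 hA]
  · rw [← hc]
    exact hasSum_sum_of_ne_finset_zero (L := .unconditional _) fun A hA => by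
      simp [Finsupp.notMem_support_iff.1 hA]

lemma IsLocal.inDomain_iterate {f : C(Config d, ℝ)} (hf : IsLocal f)
    (hq : ∀ B, (q B).card ≤ B.card) (hu : 0 < u)
    (hlam : Summable fun B : 𝓑 => |lam B| * Real.exp (u * (B : Finset (Site d)).card)) (n : ℕ) :
    InDomain 𝓑 lam q ((gen 𝓑 lam q)^[n] f) := by
  -- A local function has a finite expansion, so any rate is allowed; u/2 is the largest with 2r ≤
  -- u.
  obtain ⟨K, hK⟩ := hf.hasExpansion (u / 2)
  obtain ⟨ι, c, A, h, -⟩ := hK.iterate_gen hq (half_pos hu) (by linarith) hlam n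
  exact h.inDomain (by positivity) (summable_lam hu.le hlam)

lemma IsLocal.iterate_mem_closure {f : C(Config d, ℝ)} (hf : IsLocal f)
    (hq : ∀ B, (q B).card ≤ B.card) (hu : 0 < u)
    (hlam : Summable fun B : 𝓑 => |lam B| * Real.exp (u * (B : Finset (Site d)).card)) (n : ℕ) :
    ((gen 𝓑 lam q)^[n] f, (gen 𝓑 lam q)^[n + 1] f) ∈
      closure {p : C(Config d, ℝ) × C(Config d, ℝ) | IsLocal p.1 ∧ p.2 = gen 𝓑 lam q p.1} := by
  obtain ⟨K, hK⟩ := hf.hasExpansion (u / 2)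
  obtain ⟨ι, c, A, h, -⟩ := hK.iterate_gen hq (half_pos hu) (by linarith) hlam n
  rw [Function.iterate_succ_apply']
  exact h.mem_closure (by positivity) (summable_lam hu.le hlam)

lemma IsLocal.norm_iterate_le {f : C(Config d, ℝ)} (hf : IsLocal f)
    (hq : ∀ B, (q B).card ≤ B.card) (hu : 0 < u)
    (hlam : Summable fun B : 𝓑 => |lam B| * Real.exp (u * (B : Finset (Site d)).card)) :
    ∃ C κ : ℝ, 0 < C ∧ 0 < κ ∧ ∀ n : ℕ,
      ‖(gen 𝓑 lam q)^[n] f‖ ≤ C * (n ! : ℝ) * κ ^ n := by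
  obtain ⟨K, hK⟩ := hf.hasExpansion (u / 2)
  have hM : 0 ≤ ∑' B : 𝓑, |lam B| * Real.exp (u * (B : Finset (Site d)).card) :=
    tsum_nonneg fun _ => by positivity
  have hK0 := hK.nonneg
  -- The added ones keep both constants positive when K or the sum over 𝓑 is zero.
  refine ⟨K * Real.exp 1 + 1, 2 * (∑' B : 𝓑, |lam B| * Real.exp (u * (B : Finset (Site d)).card)) /
    (u / 2) * Real.exp 1 + 1, by positivity, by positivity, fun n => ?_⟩
  refine ((hK.iterate_gen hq (half_pos hu) (by linarith) hlam n).norm_le (by positivity)).trans ?_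
  gcongr <;> linarith

lemma IsLocal.isAnalyticVector {f : C(Config d, ℝ)} (hf : IsLocal f)
    (hq : ∀ B, (q B).card ≤ B.card) (hu : 0 < u)
    (hlam : Summable fun B : 𝓑 => |lam B| * Real.exp (u * (B : Finset (Site d)).card)) :
    IsAnalyticVector 𝓑 lam q f := by
  refine ⟨hf.inDomain_iterate hq hu hlam, ?_⟩
  obtain ⟨C, κ, hC, hκ, h⟩ := hf.norm_iterate_le hq hu hlam
  refine ⟨(2 * κ)⁻¹, by positivity, ?_⟩
  refine Summable.of_nonneg_of_le (fun n => by positivity) (fun n => ?_)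
    (summable_geometric_two.mul_left C)
  calc _ ≤ (2 * κ)⁻¹ ^ n / (n ! : ℝ) * (C * (n ! : ℝ) * κ ^ n) := by
        gcongr
        exact h n
    _ = C * ((2 * κ)⁻¹ * κ) ^ n := by
        rw [mul_pow]
        field_simp
    _ = C * (1 / 2) ^ n := by
        congr 2
        field_simp

lemma exists_norm_iterate_spin_le (hq : ∀ B, (q B).card ≤ B.card) (hu : 0 < u)
    (hlam : Summable fun B : 𝓑 => |lam B| * Real.exp (u * (B : Finset (Site d)).card))
    (A : Finset (Site d)) :
    ∃ κ : ℝ, 0 < κ ∧ ∀ n : ℕ, 1 ≤ n →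
      ‖(gen 𝓑 lam q)^[n] (spin A)‖ ≤ (n ! : ℝ) * κ ^ n := by
  obtain ⟨C, κ, hC, hκ, h⟩ := (isLocal_spin A).norm_iterate_le hq hu hlam
  -- The prefactor is absorbed through C ≤ (C+1)^n, which uses n ≥ 1.
  refine ⟨(C + 1) * κ, by positivity, fun n hn => (h n).trans ?_⟩
  rw [mul_pow]
  have h1 : C ≤ (C + 1) ^ n :=
    (by linarith : C ≤ C + 1).trans (le_self_pow₀ (by linarith) (by omega))
  calc C * (n ! : ℝ) * κ ^ n = C * ((n ! : ℝ) * κ ^ n) := by ring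
    _ ≤ (C + 1) ^ n * ((n ! : ℝ) * κ ^ n) := by gcongr
    _ = _ := by ring

end PowerBounds

end SpinFlip

end

noncomputable section

namespace SpinFlip

/-! ### Backward uniqueness for chains of derivatives -/

section BackwardUniqueness

variable {F : ℕ → ℝ → ℝ} {C κ : ℝ}

/-- Taylor's remainder at t, read backwards: F_k(s) is minus the integral of F_{k+1} over [s, t], so
the induction on n must cover all k at once. -/
lemma abs_le_of_deriv_chain (hcont : ∀ k, Continuous (F k))
    (hder : ∀ k s, 0 ≤ s → HasDerivWithinAt (F k) (F (k + 1) s) (Set.Ioi s) s)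
    (hb : ∀ k s, |F k s| ≤ C * (k ! : ℝ) * κ ^ k) {t : ℝ} (h0 : ∀ k, F k t = 0) (n : ℕ) :
    ∀ k s, 0 ≤ s → s ≤ t →
      |F k s| ≤ C * ((k + n)! : ℝ) * κ ^ (k + n) * ((t - s) ^ n / (n ! : ℝ)) := by
  induction n with
  | zero =>
    intro k s _ _
    simpa using hb k s
  | succ n ih =>
    intro k s hs hst
    have hint : ∫ x in s..t, F (k + 1) x = F k t - F k s := by
      refine intervalIntegral.integral_eq_sub_of_hasDeriv_right (hcont k).continuousOn
        (fun x hx => hder k x ?_) ((hcont (k + 1)).intervalIntegrable _ _)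
      rw [min_eq_left hst] at hx
      exact hs.trans hx.1.le
    have hle := intervalIntegral.norm_integral_le_of_norm_le (μ := volume) (f := F (k + 1))
      (g := fun x => C * ((k + 1 + n)! : ℝ) * κ ^ (k + 1 + n) * ((t - x) ^ n / (n ! : ℝ))) hst
      (Eventually.of_forall fun x hx => ih (k + 1) x (hs.trans hx.1.le) hx.2)
      (Continuous.intervalIntegrable (by fun_prop) _ _)
    have hpow : ∫ x in s..t, (t - x) ^ n = (t - s) ^ (n + 1) / (n + 1) := by
      rw [intervalIntegral.integral_comp_sub_left (fun x => x ^ n) t, integral_pow]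
      simp
    rw [hint, h0, zero_sub, norm_neg, Real.norm_eq_abs, intervalIntegral.integral_const_mul,
      intervalIntegral.integral_div, hpow] at hle
    refine hle.trans (le_of_eq ?_)
    rw [show k + 1 + n = k + (n + 1) by ring, Nat.factorial_succ n]
    push_cast
    rw [div_div]

/-- Since (k+n)! ≤ 2^{k+n} k! n!, the remainder is of order (2κ(t-s))^n ≤ 2^{-n}, for every n. -/
lemma eq_zero_of_deriv_chain_of_near (hC : 0 ≤ C) (hκ : 0 < κ) (hcont : ∀ k, Continuous (F k))
    (hder : ∀ k s, 0 ≤ s → HasDerivWithinAt (F k) (F (k + 1) s) (Set.Ioi s) s)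
    (hb : ∀ k s, |F k s| ≤ C * (k ! : ℝ) * κ ^ k) {t : ℝ} (h0 : ∀ k, F k t = 0) (k : ℕ) {s : ℝ}
    (hs : 0 ≤ s) (hst : s ≤ t) (hts : t - s ≤ (4 * κ)⁻¹) : F k s = 0 := by
  have hbound : ∀ n : ℕ, |F k s| ≤ C * (k ! : ℝ) * (2 * κ) ^ k * (1 / 2) ^ n := by
    intro n
    refine (abs_le_of_deriv_chain hcont hder hb h0 n k s hs hst).trans ?_
    have hfac : ((k + n)! : ℝ) ≤ 2 ^ (k + n) * (k ! : ℝ) * (n ! : ℝ) := by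
      rw [← Nat.add_choose_mul_factorial_mul_factorial k n]
      push_cast
      gcongr
      exact_mod_cast Nat.choose_le_two_pow (k + n) n
    have hn : (0 : ℝ) < (n ! : ℝ) := by positivity
    have hx : 2 * κ * (t - s) ≤ 1 / 2 := by
      have := mul_le_mul_of_nonneg_left hts (by positivity : 0 ≤ 2 * κ)
      refine this.trans (le_of_eq ?_)
      field_simp
      norm_num
    have hts0 : 0 ≤ t - s := sub_nonneg.2 hst
    calc _ ≤ C * (2 ^ (k + n) * (k ! : ℝ) * (n ! : ℝ)) * κ ^ (k + n) *
          ((t - s) ^ n / (n ! : ℝ)) := by gcongr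
      _ = C * (k ! : ℝ) * (2 * κ) ^ k * (2 * κ * (t - s)) ^ n := by
          rw [mul_pow (2 * κ) (t - s), mul_pow, mul_pow]
          field_simp
          ring
      _ ≤ _ := by gcongr
  have hlim : Tendsto (fun n : ℕ => C * (k ! : ℝ) * (2 * κ) ^ k * (1 / 2 : ℝ) ^ n) atTop (𝓝 0) := by
    simpa using (tendsto_pow_atTop_nhds_zero_of_lt_one (by norm_num : (0 : ℝ) ≤ 1 / 2)
      (by norm_num)).const_mul (C * (k ! : ℝ) * (2 * κ) ^ k)
  exact abs_nonpos_iff.1 (ge_of_tendsto' hlim hbound)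

/-- A chain of functions, each the right derivative of the preceding one, with analytic bounds,
vanishes on `[0, ∞)` as soon as it vanishes eventually. -/
lemma eq_zero_of_deriv_chain (hC : 0 ≤ C) (hκ : 0 < κ) (hcont : ∀ k, Continuous (F k))
    (hder : ∀ k s, 0 ≤ s → HasDerivWithinAt (F k) (F (k + 1) s) (Set.Ioi s) s)
    (hb : ∀ k s, |F k s| ≤ C * (k ! : ℝ) * κ ^ k) {t : ℝ}
    (h0 : ∀ k s, t ≤ s → F k s = 0) (k : ℕ) {s : ℝ} (hs : 0 ≤ s) : F k s = 0 := by
  have hκ' : 0 < (4 * κ)⁻¹ := by positivity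
  -- The step length 1/(4κ) depends on neither k nor the base point, because the bounds are uniform
  -- in s. Finitely many steps therefore reach any s ≥ 0.
  have key : ∀ m : ℕ, ∀ k s, 0 ≤ s → t - m * (4 * κ)⁻¹ ≤ s → F k s = 0 := by
    intro m
    induction m with
    | zero =>
      intro k s _ h
      exact h0 k s (by simpa using h)
    | succ m ih =>
      intro k s hs h
      push_cast at h
      rcases le_total (t - m * (4 * κ)⁻¹) s with h' | h'
      · exact ih k s hs h'
      · exact eq_zero_of_deriv_chain_of_near hC hκ hcont hder hb
          (fun k => ih k _ (hs.trans h') le_rfl) k hs h' (by linarith)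
  obtain ⟨m, hm⟩ := exists_nat_ge (t / (4 * κ)⁻¹)
  rw [div_le_iff₀ hκ'] at hm
  exact key m k s hs (by linarith)

end BackwardUniqueness

/-! ### Feller semigroups: continuity, right derivatives, merging of measures -/

namespace FellerSemigroup

variable {d : ℕ} (S : FellerSemigroup d)

instance (t : ℝ≥0) : IsMarkovKernel (S.kernel t) := S.markov t

lemma _root_.SpinFlip.integrable_config (μ : Measure (Config d)) [IsFiniteMeasure μ]
    (f : C(Config d, ℝ)) : Integrable f μ :=
  Integrable.of_bound f.continuous.aestronglyMeasurable ‖f‖ (ae_of_all _ f.norm_coe_le_norm)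

lemma _root_.SpinFlip.abs_integral_config_le (μ : Measure (Config d)) [IsProbabilityMeasure μ]
    (f : C(Config d, ℝ)) : |∫ σ, f σ ∂μ| ≤ ‖f‖ := by
  simpa using norm_integral_le_of_norm_le_const (μ := μ) (ae_of_all _ f.norm_coe_le_norm)

lemma act_apply (t : ℝ≥0) (f : C(Config d, ℝ)) (σ : Config d) :
    S.act t f σ = ∫ ξ, f ξ ∂(S.kernel t σ) := rfl

/-- The operator `S(t)` as a continuous linear map. -/
def actL (t : ℝ≥0) : C(Config d, ℝ) →L[ℝ] C(Config d, ℝ) :=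
  LinearMap.mkContinuous
    { toFun := S.act t
      map_add' := fun f g => by
        ext σ
        exact integral_add (integrable_config _ f) (integrable_config _ g)
      map_smul' := fun a f => by
        ext σ
        exact integral_const_mul a _ } 1 fun f => by
    rw [one_mul, ContinuousMap.norm_le _ (norm_nonneg _)]
    exact fun σ => abs_integral_config_le _ f

@[simp] lemma actL_apply (t : ℝ≥0) (f : C(Config d, ℝ)) : S.actL t f = S.act t f := rfl

lemma norm_act_le (t : ℝ≥0) (f : C(Config d, ℝ)) : ‖S.act t f‖ ≤ ‖f‖ := by
  rw [ContinuousMap.norm_le _ (norm_nonneg _)]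
  exact fun σ => abs_integral_config_le _ f

lemma act_zero (f : C(Config d, ℝ)) : S.act 0 f = f := by
  ext σ
  rw [act_apply, S.kernel_zero, Kernel.id_apply]
  exact integral_dirac _ _

lemma act_add (s t : ℝ≥0) (f : C(Config d, ℝ)) : S.act (s + t) f = S.act s (S.act t f) := by
  ext σ
  rw [act_apply, S.kernel_add, Kernel.integral_comp (integrable_config _ f)]
  rfl

/-- Viewing μ as a constant kernel turns this into the integral formula for a composition of
kernels. -/
lemma integral_evolve (t : ℝ≥0) (μ : Measure (Config d)) [IsProbabilityMeasure μ]
    (f : C(Config d, ℝ)) : ∫ σ, f σ ∂(S.evolve t μ) = ∫ σ, S.act t f σ ∂μ := by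
  have h : S.evolve t μ = (S.kernel t ∘ₖ Kernel.const Unit μ) () := by
    rw [Kernel.comp_apply, Kernel.const_apply]
    rfl
  rw [h, Kernel.integral_comp (integrable_config _ f), Kernel.const_apply]
  rfl

lemma tendsto_act_zero (f : C(Config d, ℝ)) : Tendsto (fun t => S.act t f) (𝓝 0) (𝓝 f) :=
  ContinuousMap.tendsto_iff_tendstoUniformly.2 (S.strong_continuity f)

lemma act_sub_act {s t : ℝ≥0} (h : s ≤ t) (f : C(Config d, ℝ)) :
    S.act t f - S.act s f = S.act s (S.act (t - s) f - f) := by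
  rw [← actL_apply S s (_ - f), map_sub, actL_apply, actL_apply, ← act_add, add_tsub_cancel_of_le h]

/-- Factor out the operator at the earlier time, which is a contraction; continuity everywhere then
follows from continuity at time 0. -/
lemma norm_act_sub_act_le (s t : ℝ≥0) (f : C(Config d, ℝ)) :
    ‖S.act t f - S.act s f‖ ≤ ‖S.act (nndist t s) f - f‖ := by
  wlog h : s ≤ t generalizing s t
  · rw [norm_sub_rev, nndist_comm]
    exact this t s (le_of_not_ge h)
  have : nndist t s = t - s := by
    rw [NNReal.nndist_eq, tsub_eq_zero_of_le h, max_eq_left zero_le]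
  rw [this, S.act_sub_act h]
  exact S.norm_act_le _ _

lemma continuous_act (f : C(Config d, ℝ)) : Continuous fun t => S.act t f := by
  refine continuous_iff_continuousAt.2 fun s => ?_
  rw [ContinuousAt, tendsto_iff_norm_sub_tendsto_zero]
  refine squeeze_zero (fun _ => norm_nonneg _) (fun t => S.norm_act_sub_act_le s t f) ?_
  have h1 : Tendsto (fun t => nndist t s) (𝓝 s) (𝓝 0) := by
    have : Continuous fun t => nndist t s := by fun_prop
    simpa using this.tendsto s
  exact tendsto_iff_norm_sub_tendsto_zero.1 ((S.tendsto_act_zero f).comp h1)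

/-- The difference quotient at s is S(s) applied to the one at 0. This gives the right derivative
only, which is all that the chain argument asks for. -/
lemma hasDerivWithinAt_act {f g : C(Config d, ℝ)} (h : (f, g) ∈ S.generatorGraph) {s : ℝ}
    (hs : 0 ≤ s) :
    HasDerivWithinAt (fun t : ℝ => S.act t.toNNReal f) (S.act s.toNNReal g) (Set.Ioi s) s := by
  rw [hasDerivWithinAt_iff_tendsto_slope' Set.self_notMem_Ioi]
  have h1 : Tendsto (fun t : ℝ => (t - s).toNNReal) (𝓝[>] s) (𝓝[>] 0) := by
    refine tendsto_nhdsWithin_iff.2 ⟨?_, ?_⟩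
    · have : Continuous fun t : ℝ => (t - s).toNNReal := by fun_prop
      simpa using (this.tendsto s).mono_left nhdsWithin_le_nhds
    · filter_upwards [self_mem_nhdsWithin] with t ht
      exact Real.toNNReal_pos.2 (sub_pos.2 ht)
  have h2 : Tendsto (fun t : ℝ≥0 => (t : ℝ)⁻¹ • (S.act t f - f)) (𝓝[>] 0) (𝓝 g) := h
  refine (((S.actL s.toNNReal).continuous.tendsto g).comp (h2.comp h1)).congr' ?_
  filter_upwards [self_mem_nhdsWithin] with t ht
  have hst : s ≤ t := le_of_lt ht
  have hsub : (t - s).toNNReal = t.toNNReal - s.toNNReal := by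
    rw [NNReal.sub_def, Real.coe_toNNReal t (hs.trans hst), Real.coe_toNNReal s hs]
  rw [slope_def_module, S.act_sub_act (Real.toNNReal_le_toNNReal hst),
    ← hsub, Function.comp_apply, Function.comp_apply, map_smul,
    Real.coe_toNNReal _ (sub_nonneg.2 hst), actL_apply]

/-- The difference of two expectations as a continuous linear functional. -/
def _root_.SpinFlip.integralSub (μ ν : Measure (Config d)) [IsProbabilityMeasure μ]
    [IsProbabilityMeasure ν] : C(Config d, ℝ) →L[ℝ] ℝ :=
  LinearMap.mkContinuous
    { toFun := fun f => ∫ σ, f σ ∂μ - ∫ σ, f σ ∂ν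
      map_add' := fun f g => by
        simp only [ContinuousMap.add_apply]
        rw [integral_add (integrable_config _ f) (integrable_config _ g),
          integral_add (integrable_config _ f) (integrable_config _ g)]
        ring
      map_smul' := fun a f => by
        simp only [ContinuousMap.smul_apply, smul_eq_mul, integral_const_mul, RingHom.id_apply]
        ring } 2 fun f => by
    refine (norm_sub_le _ _).trans ?_
    have h1 := abs_integral_config_le μ f
    have h2 := abs_integral_config_le ν f
    simp only [Real.norm_eq_abs]
    linarith

lemma _root_.SpinFlip.integralSub_apply (μ ν : Measure (Config d)) [IsProbabilityMeasure μ]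
    [IsProbabilityMeasure ν] (f : C(Config d, ℝ)) :
    integralSub μ ν f = ∫ σ, f σ ∂μ - ∫ σ, f σ ∂ν := rfl

lemma _root_.SpinFlip.abs_integralSub_le (μ ν : Measure (Config d)) [IsProbabilityMeasure μ]
    [IsProbabilityMeasure ν] (f : C(Config d, ℝ)) : |integralSub μ ν f| ≤ 2 * ‖f‖ := by
  have h1 := abs_integral_config_le μ f
  have h2 := abs_integral_config_le ν f
  rw [integralSub_apply]
  exact (abs_sub _ _).trans (by linarith)

lemma _root_.SpinFlip.eq_of_integralSub_eq_zero {μ ν : Measure (Config d)}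
    [IsProbabilityMeasure μ] [IsProbabilityMeasure ν]
    (h : ∀ f : C(Config d, ℝ), IsLocal f → integralSub μ ν f = 0) : μ = ν := by
  have h0 : (fun f => integralSub μ ν f) = fun _ => (0 : ℝ) :=
    Continuous.ext_on dense_isLocal (integralSub μ ν).continuous continuous_const h
  refine ext_of_forall_integral_eq_of_IsFiniteMeasure fun f => ?_
  exact sub_eq_zero.1 (congrFun h0 f.toContinuousMap)

/-- Two measures that the semigroup merges have the same expectation of a function with powers of
the generator that grow at an analytic rate. -/
lemma integralSub_eq_zero {g : ℕ → C(Config d, ℝ)}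
    (hg : ∀ n, (g n, g (n + 1)) ∈ S.generatorGraph) {C κ : ℝ} (hC : 0 ≤ C) (hκ : 0 < κ)
    (hb : ∀ n, ‖g n‖ ≤ C * (n ! : ℝ) * κ ^ n) {μ ν : Measure (Config d)} [IsProbabilityMeasure μ]
    [IsProbabilityMeasure ν] {t : ℝ≥0} (h : S.evolve t μ = S.evolve t ν) :
    integralSub μ ν (g 0) = 0 := by
  have hvanish : ∀ f : C(Config d, ℝ), integralSub μ ν (S.act t f) = 0 := fun f => by
    rw [integralSub_apply, ← integral_evolve, ← integral_evolve, h, sub_self]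
  have key := eq_zero_of_deriv_chain (C := 2 * C) (κ := κ) (t := t)
    (F := fun n s => integralSub μ ν (S.act s.toNNReal (g n))) (by positivity) hκ
    (fun n => (integralSub μ ν).continuous.comp
      ((S.continuous_act (g n)).comp continuous_real_toNNReal))
    (fun n s hs =>
      (integralSub μ ν).hasFDerivAt.comp_hasDerivWithinAt s
        (S.hasDerivWithinAt_act (hg n) hs))
    (fun n s => by
      have h1 := abs_integralSub_le μ ν (S.act s.toNNReal (g n))
      have h2 := (S.norm_act_le s.toNNReal (g n)).trans (hb n)
      linarith)
    (fun n s hs => by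
      -- Beyond t the semigroup factors through S(t), so measures merged at time t stay merged.
      have hts : t ≤ s.toNNReal := NNReal.le_toNNReal_of_coe_le hs
      rw [← add_tsub_cancel_of_le hts, S.act_add]
      exact hvanish _) 0 le_rfl
  simpa [act_zero] using key

end FellerSemigroup

lemma nonDegenerate_of_isGeneratedBy {d : ℕ} {𝓑 : Set (Finset (Site d))}
    {lam : Finset (Site d) → ℝ} {q : Finset (Site d) → Finset (Site d)} {u : ℝ}
    (hq : ∀ B, (q B).card ≤ B.card) (hu : 0 < u)
    (hlam : Summable fun B : 𝓑 => |lam B| * Real.exp (u * (B : Finset (Site d)).card))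
    (S : FellerSemigroup d) (hS : S.IsGeneratedBy 𝓑 lam q) : S.NonDegenerate := by
  intro μ ν hμ hν hne t _ h
  refine hne (eq_of_integralSub_eq_zero fun f hf => ?_)
  obtain ⟨C, κ, hC, hκ, hb⟩ := hf.norm_iterate_le hq hu hlam
  refine S.integralSub_eq_zero (g := fun n => (gen 𝓑 lam q)^[n] f) (fun n => ?_) hC.le hκ hb h
  -- The generator is the closure of 𝓛 on local functions, so it suffices that the pairs of
  -- consecutive powers lie in that closure.
  rw [hS]
  exact hf.iterate_mem_closure hq hu hlam n

end SpinFlip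

end

theorem mainTheorem6 (d : ℕ) (𝓑 : Set (Finset (SpinFlip.Site d)))
    (lam : Finset (SpinFlip.Site d) → ℝ)
    (q : Finset (SpinFlip.Site d) → Finset (SpinFlip.Site d))
    (hq : (∀ B, q B = ∅) ∨ (∀ B, q B = B))
    (c u : ℝ) (hc : 0 < c) (hu : 0 < u) (ψ : ℕ → ℝ≥0)
    (hlam : ∀ k : ℕ, ∑' B : {B : Finset (SpinFlip.Site d) // B ∈ 𝓑 ∧ B.card = k},
      ENNReal.ofReal |lam B| ≤ ENNReal.ofReal (c * ψ k))
    (hψ : Summable fun k : ℕ => Real.exp (u * k) * (ψ k : ℝ)) :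
    (∀ A : Finset (SpinFlip.Site d),
      (∀ n : ℕ, SpinFlip.InDomain 𝓑 lam q
        ((SpinFlip.gen 𝓑 lam q)^[n] (SpinFlip.spin A))) ∧
      ∃ κ : ℝ, 0 < κ ∧ ∀ n : ℕ, 1 ≤ n →
        ‖(SpinFlip.gen 𝓑 lam q)^[n] (SpinFlip.spin A)‖ ≤ (n ! : ℝ) * κ ^ n) ∧
    (∀ f : C(SpinFlip.Config d, ℝ), SpinFlip.IsLocal f →
      SpinFlip.IsAnalyticVector 𝓑 lam q f) ∧
    (∀ S : SpinFlip.FellerSemigroup d, S.IsGeneratedBy 𝓑 lam q → S.NonDegenerate) := by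
  -- The two forms of the operator enter the estimates only through |q(B)| ≤ |B|.
  have hq' : ∀ B, (q B).card ≤ B.card := by
    rcases hq with hq | hq <;> intro B <;> simp [hq B]
  have hsum := SpinFlip.summable_lam_exp hlam hψ
  exact ⟨fun A => ⟨(SpinFlip.isLocal_spin A).inDomain_iterate hq' hu hsum,
      SpinFlip.exists_norm_iterate_spin_le hq' hu hsum A⟩,
    fun f hf => hf.isAnalyticVector hq' hu hsum,
    SpinFlip.nonDegenerate_of_isGeneratedBy hq' hu hsum⟩
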